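/- Let $p>3$ be a prime. For $t\in\mathbb{F}_p$ with $t\neq 0,1$, let $E_t$ be the elliptic curve over $\mathbb{F}_p$ given by $y^2+3xy+ty=x^3$. For an elliptic curve $E$ over $\mathbb{F}_p$, let $a_p(E)=p+1-\#E(\mathbb{F}_p)$ be its trace of Frobenius, where $\#E(\mathbb{F}_p)$ counts the $\mathbb{F}_p$-points of $E$ including the point at infinity. Then for every $t\in\mathbb{F}_p$ with $t\neq 0,1$, $$a_p(E_t)=\left(\frac{-3}{p}\right)a_p(E_{1-t}),$$ where $\left(\frac{\cdot}{p}\right)$ is the Legendre symbol. -/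

import Mathlib

/-- The trace of Frobenius `a_p(W) = p + 1 - #W(𝔽_p)` of a Weierstrass curve over `𝔽_p`. The type
`W.toAffine.Point` consists of the point at infinity and the nonsingular affine `𝔽_p`-points; on an
elliptic curve every affine point is nonsingular, so these are all the `𝔽_p`-points. -/
noncomputable def traceOfFrobenius (p : ℕ) (W : WeierstrassCurve (ZMod p)) : ℤ :=
  (p : ℤ) + 1 - (Nat.card W.toAffine.Point : ℤ)

/-- The Weierstrass curve `E_t : y² + 3xy + ty = x³` over `𝔽_p`. -/
def curveE (p : ℕ) (t : ZMod p) : WeierstrassCurve (ZMod p) where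
  a₁ := 3
  a₂ := 0
  a₃ := t
  a₄ := 0
  a₆ := 0

/-- The affine equation of `curveE p t` is the intended one. -/
theorem curveE_equation_iff (p : ℕ) (t x y : ZMod p) :
    (curveE p t).toAffine.Equation x y ↔ y ^ 2 + 3 * x * y + t * y = x ^ 3 := by
  simp [WeierstrassCurve.Affine.equation_iff, curveE]

/-- For `p > 3` and `t ≠ 0, 1` the curve `curveE p t` is an elliptic curve. -/
theorem curveE_isElliptic (p : ℕ) [Fact p.Prime] (hp : 3 < p) (t : ZMod p)
    (h0 : t ≠ 0) (h1 : t ≠ 1) : (curveE p t).IsElliptic := by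
  have h3 : (3 : ZMod p) ≠ 0 := by
    intro h
    have h' : ((3 : ℕ) : ZMod p) = 0 := by exact_mod_cast h
    rw [ZMod.natCast_eq_zero_iff] at h'
    exact absurd (Nat.le_of_dvd (by norm_num) h') (by omega)
  have hΔ : (curveE p t).Δ = 3 ^ 3 * t ^ 3 * (1 - t) := by
    simp only [WeierstrassCurve.Δ, WeierstrassCurve.b₂, WeierstrassCurve.b₄,
      WeierstrassCurve.b₆, WeierstrassCurve.b₈, curveE]
    ring
  refine ⟨?_⟩
  rw [hΔ, isUnit_iff_ne_zero]
  exact mul_ne_zero (mul_ne_zero (pow_ne_zero _ h3) (pow_ne_zero _ h0))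
    (sub_ne_zero.mpr (Ne.symm h1))

/-! Put χ = (-3/p), let S(t) be `cubicCharSum t`, so that a_p(E_t) = -S(t), and let k = 2 + χ be the
number of cube roots of unity. The Hesse cubic H : u³ + w³ + t = 3uw links the two curves. Slicing
by u + w gives H exactly p - 1 + χ(S(1-t) - 1) affine points (`card_affine_hesse`). The map (u, w) ↦
(-uw, u³) is k-to-1 from H onto the affine points in the kernel of the 3-descent map E_t(𝔽_p) →
𝔽_pˣ/cubes (`card_hesse_eq_mul`), so k·#ker = p + 1 + χS(1-t).

The target of descent has at most k elements, hence #ker ≤ #E_t(𝔽_p) ≤ k·#ker. If χ = -1, then k = 1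
and equality holds. If χ = 1, the upper bound reads S(t) ≤ S(1-t), and exchanging t with 1-t gives
the reverse. Surjectivity of descent and isogeny invariance of point counts are thus never needed.
-/

theorem card_filter_prod_eq_sum {F : Type*} [Fintype F] (P : F → F → Prop) [∀ x y, Decidable (P x y)] :
    (Finset.univ.filter fun v : F × F => P v.1 v.2).card =
      ∑ x, (Finset.univ.filter fun y => P x y).card := by
  simp only [Finset.card_filter, Fintype.sum_prod_type]

/-! ### Point counts as quadratic character sums. -/

section CharacterSums

variable {F : Type*} [Field F] [Fintype F] [DecidableEq F]

/-- The number of solutions of a monic quadratic equation in terms of its discriminant. -/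
theorem card_monic_quadratic (h2 : (2 : F) ≠ 0) (b c : F) :
    ((Finset.univ.filter fun y : F => y ^ 2 + b * y = c).card : ℤ) =
      quadraticChar F (b ^ 2 + 4 * c) + 1 := by
  have hF : ringChar F ≠ 2 := fun h => h2 (by
    have := ringChar.Nat.cast_ringChar (R := F)
    rw [h] at this
    exact_mod_cast this)
  rw [← quadraticChar_card_sqrts hF]
  norm_cast
  refine Finset.card_bij' (fun y _ => 2 * y + b) (fun z _ => (z - b) / 2) ?_ ?_ ?_ ?_
  · intro y hy
    simp only [Finset.mem_filter, Finset.mem_univ, true_and, Set.mem_toFinset,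
      Set.mem_ofPred_eq] at hy ⊢
    linear_combination 4 * hy
  · intro z hz
    simp only [Finset.mem_filter, Finset.mem_univ, true_and, Set.mem_toFinset,
      Set.mem_ofPred_eq] at hz ⊢
    field_simp
    linear_combination hz
  · intro y _
    field_simp
    ring
  · intro z _
    field_simp
    ring

theorem quadraticChar_sq_mul {c : F} (hc : c ≠ 0) (z : F) :
    quadraticChar F (c ^ 2 * z) = quadraticChar F z := by
  rw [map_mul, quadraticChar_sq_one' hc, one_mul]

variable (F) in
/-- The number of cube roots of unity. -/
def cubeRootCount : ℕ := (Finset.univ.filter fun z : F => z ^ 3 = 1).card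

theorem cubeRootCount_eq (h2 : (2 : F) ≠ 0) (h3 : (3 : F) ≠ 0) :
    (cubeRootCount F : ℤ) = 2 + quadraticChar F (-3) := by
  have h := card_monic_quadratic h2 (1 : F) (-1)
  rw [show (1 : F) ^ 2 + 4 * -1 = -3 by ring] at h
  have hs : (Finset.univ.filter fun z : F => z ^ 3 = 1) =
      insert 1 (Finset.univ.filter fun y : F => y ^ 2 + 1 * y = -1) := by
    ext z
    simp only [Finset.mem_filter, Finset.mem_univ, true_and, Finset.mem_insert]
    rw [← sub_eq_zero, show z ^ 3 - 1 = (z - 1) * (z ^ 2 + 1 * z - -1) by ring, mul_eq_zero,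
      sub_eq_zero, sub_eq_zero]
  have hn : (1 : F) ∉ Finset.univ.filter fun y : F => y ^ 2 + 1 * y = -1 := by
    simp only [Finset.mem_filter, Finset.mem_univ, true_and]
    intro h
    exact h3 (by linear_combination h)
  rw [cubeRootCount, hs, Finset.card_insert_of_notMem hn]
  push_cast
  linarith

theorem card_cube_roots {a : F} (ha : a ≠ 0) (h : ∃ u, u ^ 3 = a) :
    (Finset.univ.filter fun u : F => u ^ 3 = a).card = cubeRootCount F := by
  obtain ⟨c, rfl⟩ := h
  have hc : c ≠ 0 := by
    rintro rfl
    simp at ha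
  refine Finset.card_bij' (fun u _ => u / c) (fun z _ => z * c) ?_ ?_ ?_ ?_
  · intro u hu
    simp only [Finset.mem_filter, Finset.mem_univ, true_and] at hu ⊢
    rw [div_pow, hu, div_self ha]
  · intro z hz
    simp only [Finset.mem_filter, Finset.mem_univ, true_and] at hz ⊢
    rw [mul_pow, hz, one_mul]
  · intro u _
    field_simp
  · intro u _
    field_simp

/-- The character sum attached to the cubics `(1 + 3q)² + 4tq³`. -/
def cubicCharSum (t : F) : ℤ := ∑ q : F, quadraticChar F ((1 + 3 * q) ^ 2 + 4 * t * q ^ 3)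

/-- Each fibre over x is a quadratic in y; the scaling x = tq makes its discriminant t² times the
cubic in `cubicCharSum`. -/
theorem card_affine_curveE (h2 : (2 : F) ≠ 0) {t : F} (h0 : t ≠ 0) :
    ((Finset.univ.filter fun v : F × F =>
      v.2 ^ 2 + 3 * v.1 * v.2 + t * v.2 = v.1 ^ 3).card : ℤ) =
      Fintype.card F + cubicCharSum t := by
  have hp := card_filter_prod_eq_sum fun x y : F => y ^ 2 + 3 * x * y + t * y = x ^ 3
  beta_reduce at hp
  rw [hp]
  push_cast
  have h : ∀ x : F, ((Finset.univ.filter fun y : F =>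
      y ^ 2 + 3 * x * y + t * y = x ^ 3).card : ℤ) =
      quadraticChar F ((3 * x + t) ^ 2 + 4 * x ^ 3) + 1 := fun x => by
    rw [← card_monic_quadratic h2]
    simp only [add_mul, ← add_assoc]
  simp only [h, Finset.sum_add_distrib]
  rw [← Equiv.sum_comp (Equiv.mulLeft₀ t h0), cubicCharSum, add_comm]
  congr 1
  · simp
  · refine Finset.sum_congr rfl fun q _ => ?_
    change quadraticChar F ((3 * (t * q) + t) ^ 2 + 4 * (t * q) ^ 3) = _
    rw [← quadraticChar_sq_mul h0 ((1 + 3 * q) ^ 2 + 4 * t * q ^ 3)]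
    congr 1
    ring

/-- With s = u + w the u³ terms cancel, leaving a quadratic in u with leading coefficient 3(s + 1).
For q = -1/(s + 1) its discriminant is, up to a nonzero square, -3((1 + 3q)² + 4(1 - t)q³). -/
theorem card_affine_hesse (h2 : (2 : F) ≠ 0) (h3 : (3 : F) ≠ 0) {t : F} (h1 : t ≠ 1) :
    ((Finset.univ.filter fun v : F × F =>
      v.1 ^ 3 + v.2 ^ 3 + t = 3 * v.1 * v.2).card : ℤ) =
      Fintype.card F - 1 + quadraticChar F (-3) * (cubicCharSum (1 - t) - 1) := by
  have hb : (Finset.univ.filter fun v : F × F =>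
      v.1 ^ 3 + v.2 ^ 3 + t = 3 * v.1 * v.2).card =
      (Finset.univ.filter fun v : F × F =>
        v.2 ^ 3 + (v.1 - v.2) ^ 3 + t = 3 * v.2 * (v.1 - v.2)).card := by
    refine Finset.card_bij' (fun v _ => (v.1 + v.2, v.1)) (fun v _ => (v.2, v.1 - v.2))
      ?_ ?_ ?_ ?_ <;> intro v hv <;>
      simp only [Finset.mem_filter, Finset.mem_univ, true_and, add_sub_cancel_left,
        add_sub_cancel, Prod.mk.eta] at hv ⊢ <;> exact hv
  rw [hb, card_filter_prod_eq_sum fun s u : F => u ^ 3 + (s - u) ^ 3 + t = 3 * u * (s - u)]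
  push_cast
  -- Since 0⁻¹ = 0, q = 0 stands for s = -1, where the equation becomes t = 1 and has no solution.
  -- The omitted character value at q = 0 is 1, whence the -1 next to `cubicCharSum`.
  set g : F → ℤ := fun q => if q = 0 then 0 else
    quadraticChar F (-3) * quadraticChar F ((1 + 3 * q) ^ 2 + 4 * (1 - t) * q ^ 3) + 1 with hg
  have h : ∀ s : F, ((Finset.univ.filter fun u : F =>
      u ^ 3 + (s - u) ^ 3 + t = 3 * u * (s - u)).card : ℤ) = g (-(s + 1)⁻¹) := by
    intro s
    rcases eq_or_ne (s + 1) 0 with hs | hs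
    · simp only [hg, hs, inv_zero, neg_zero, if_true, Nat.cast_eq_zero, Finset.card_eq_zero]
      refine Finset.filter_eq_empty_iff.mpr fun u _ hu => h1 ?_
      obtain rfl : s = -1 := eq_neg_of_add_eq_zero_left hs
      linear_combination hu
    · have h3s : 3 * (s + 1) ≠ 0 := mul_ne_zero h3 hs
      have hset : (Finset.univ.filter fun u : F =>
          u ^ 3 + (s - u) ^ 3 + t = 3 * u * (s - u)) =
          Finset.univ.filter fun u : F => u ^ 2 + -s * u = -((s ^ 3 + t) / (3 * (s + 1))) := by
        ext u
        simp only [Finset.mem_filter, Finset.mem_univ, true_and]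
        rw [← neg_div, eq_div_iff h3s]
        constructor <;> intro h <;> linear_combination h
      rw [hset, card_monic_quadratic h2]
      simp only [hg, neg_eq_zero, inv_eq_zero, hs, if_false]
      rw [← map_mul, ← quadraticChar_sq_mul (div_ne_zero hs h3)
        (-3 * ((1 + 3 * -(s + 1)⁻¹) ^ 2 + 4 * (1 - t) * (-(s + 1)⁻¹) ^ 3))]
      congr 2
      field_simp
      ring
  simp only [h]
  let e : F ≃ F := (Equiv.addRight (1 : F)).trans ((Equiv.inv F).trans (Equiv.neg F))
  have he : ∑ s, g (-(s + 1)⁻¹) = ∑ q, g q := Equiv.sum_comp e g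
  rw [he, ← Finset.add_sum_erase _ _ (Finset.mem_univ (0 : F)), cubicCharSum,
    ← Finset.add_sum_erase Finset.univ (fun q : F =>
      quadraticChar F ((1 + 3 * q) ^ 2 + 4 * (1 - t) * q ^ 3)) (Finset.mem_univ (0 : F))]
  have hg0 : g 0 = 0 := by simp [hg]
  have hge : ∑ q ∈ Finset.univ.erase 0, g q = ∑ q ∈ Finset.univ.erase (0 : F),
      (quadraticChar F (-3) * quadraticChar F ((1 + 3 * q) ^ 2 + 4 * (1 - t) * q ^ 3) + 1) :=
    Finset.sum_congr rfl fun q hq => by simp only [hg, if_neg (Finset.ne_of_mem_erase hq)]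
  rw [hg0, hge, Finset.sum_add_distrib, ← Finset.mul_sum, Finset.sum_const,
    Finset.card_erase_of_mem (Finset.mem_univ _), Finset.card_univ]
  have hpos : 1 ≤ Fintype.card F := Fintype.card_pos
  simp only [mul_zero, add_zero, one_pow, ne_eq, OfNat.ofNat_ne_zero, not_false_eq_true,
    zero_pow, map_one, nsmul_eq_mul, mul_one, Nat.cast_sub hpos]
  push_cast
  ring

end CharacterSums

/-! ### The 3-descent function modulo cubes. -/

section Descent

variable {F : Type*} [Field F] [DecidableEq F] {t : F}

variable (F) in
/-- The group of nonzero elements of `F` modulo cubes. -/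
abbrev UnitsModCubes : Type _ := Fˣ ⧸ (powMonoidHom 3 : Fˣ →* Fˣ).range

omit [DecidableEq F] in
theorem mk_unitsModCubes_eq_one_iff (u : Fˣ) :
    (QuotientGroup.mk u : UnitsModCubes F) = 1 ↔ ∃ v : F, v ^ 3 = u := by
  rw [QuotientGroup.eq_one_iff, MonoidHom.mem_range]
  constructor
  · rintro ⟨v, rfl⟩
    exact ⟨v, by simp⟩
  · rintro ⟨v, hv⟩
    have hv0 : v ≠ 0 := by
      rintro rfl
      exact u.ne_zero (by rw [← hv]; simp)
    exact ⟨Units.mk0 v hv0, Units.ext (by simpa using hv)⟩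

/-- The value at a point with second coordinate `y` of the function `y` on
`y² + 3xy + ty = x³`, normalised modulo cubes at its zero `(0, 0)`. -/
def descentUnit (h0 : t ≠ 0) (y : F) : Fˣ :=
  -- Near (0, 0) the curve has y ~ x³/t, so y is t⁻¹ up to cubes.
  if h : y = 0 then (Units.mk0 t h0)⁻¹ else Units.mk0 y h

theorem descentUnit_zero (h0 : t ≠ 0) : (descentUnit h0 0 : F) = t⁻¹ := by
  simp [descentUnit]

theorem descentUnit_of_ne (h0 : t ≠ 0) {y : F} (hy : y ≠ 0) : (descentUnit h0 y : F) = y := by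
  simp [descentUnit, hy]

theorem descentUnit_mul_neg (h0 : t ≠ 0) {x y : F} (h : y ^ 2 + 3 * x * y + t * y = x ^ 3) :
    ∃ c : F, c ^ 3 = descentUnit h0 y * descentUnit h0 (-y - 3 * x - t) := by
  have hprod : y * (-y - 3 * x - t) = (-x) ^ 3 := by linear_combination -h
  rcases eq_or_ne x 0 with rfl | hx
  · refine ⟨-1, ?_⟩
    rcases mul_eq_zero.mp (hprod.trans (by simp)) with hy | hy
    · subst hy
      rw [descentUnit_zero, descentUnit_of_ne h0 (by simpa using h0)]
      field_simp
      ring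
    · rw [hy, descentUnit_zero]
      obtain rfl : y = -t := by linear_combination -hy
      rw [descentUnit_of_ne h0 (by simpa using h0)]
      field_simp
  · have hne : y * (-y - 3 * x - t) ≠ 0 := by
      rw [hprod]
      exact pow_ne_zero _ (neg_ne_zero.mpr hx)
    exact ⟨-x, by rw [descentUnit_of_ne h0 (left_ne_zero_of_mul hne),
      descentUnit_of_ne h0 (right_ne_zero_of_mul hne), hprod]⟩

/-- Collinearity through the point `(0, 0)`. -/
theorem descentUnit_mul_of_line_through_zero (h0 : t ≠ 0) {l x₂ x₃ : F}
    (h : x₂ * x₃ = -l * t) :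
    ∃ c : F, c ^ 3 = descentUnit h0 0 * descentUnit h0 (l * x₂) * descentUnit h0 (l * x₃) := by
  rcases eq_or_ne l 0 with rfl | hl
  -- The line y = 0 is the flex tangent at (0, 0): all three values are t⁻¹.
  · exact ⟨t⁻¹, by simp only [zero_mul, descentUnit_zero]; ring⟩
  · have hne : x₂ * x₃ ≠ 0 := by
      rw [h]
      exact mul_ne_zero (neg_ne_zero.mpr hl) h0
    refine ⟨-l, ?_⟩
    rw [descentUnit_zero, descentUnit_of_ne h0 (mul_ne_zero hl (left_ne_zero_of_mul hne)),
      descentUnit_of_ne h0 (mul_ne_zero hl (right_ne_zero_of_mul hne)),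
      show t⁻¹ * (l * x₂) * (l * x₃) = t⁻¹ * l ^ 2 * (x₂ * x₃) by ring, h]
    field_simp

/-- The product of the values at three collinear points is a cube. -/
theorem descentUnit_mul_of_collinear (h0 : t ≠ 0) {l m x₁ x₂ x₃ : F}
    (e₁ : x₁ + x₂ + x₃ = l * (l + 3))
    (e₂ : x₁ * x₂ + x₁ * x₃ + x₂ * x₃ = -(l * (m + t) + m * (l + 3)))
    (e₃ : x₁ * x₂ * x₃ = m * (m + t)) :
    ∃ c : F, c ^ 3 = descentUnit h0 (l * x₁ + m) * descentUnit h0 (l * x₂ + m) *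
      descentUnit h0 (l * x₃ + m) := by
  -- The xᵢ are the roots of x³ - y² - 3xy - ty with y = lx + m. Where y vanishes, at x = -m/l, only
  -- x³ remains, so the product of the values of y is m³.
  have hprod : m ^ 3 = (l * x₁ + m) * (l * x₂ + m) * (l * x₃ + m) := by
    linear_combination -l ^ 3 * e₃ - l ^ 2 * m * e₂ - l * m ^ 2 * e₁
  rcases eq_or_ne m 0 with rfl | hm
  -- The line passes through (0, 0), where the value of y is replaced by t⁻¹.
  · have hx : x₁ * x₂ * x₃ = 0 := by simpa using e₃
    simp only [add_zero]
    rcases mul_eq_zero.mp hx with hx | rfl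
    · rcases mul_eq_zero.mp hx with rfl | rfl
      · simpa using descentUnit_mul_of_line_through_zero h0 (l := l) (x₂ := x₂) (x₃ := x₃)
          (by linear_combination e₂)
      · obtain ⟨c, hc⟩ := descentUnit_mul_of_line_through_zero h0 (l := l) (x₂ := x₁) (x₃ := x₃)
          (by linear_combination e₂)
        exact ⟨c, by rw [hc, mul_zero]; ring⟩
    · obtain ⟨c, hc⟩ := descentUnit_mul_of_line_through_zero h0 (l := l) (x₂ := x₁) (x₃ := x₂)
        (by linear_combination e₂)
      exact ⟨c, by rw [hc, mul_zero]; ring⟩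
  · have hne := hprod ▸ pow_ne_zero 3 hm
    have hne' := left_ne_zero_of_mul hne
    exact ⟨m, by rw [descentUnit_of_ne h0 (left_ne_zero_of_mul hne'),
      descentUnit_of_ne h0 (right_ne_zero_of_mul hne'),
      descentUnit_of_ne h0 (right_ne_zero_of_mul hne), hprod]⟩

end Descent

/-! ### The descent homomorphism on the group of points. -/

section CurveE

open WeierstrassCurve Polynomial

variable {p : ℕ} [Fact p.Prime] {t : ZMod p}

/-- The descent class of a point of `curveE p t`. -/
def descentClass (h0 : t ≠ 0) : (curveE p t).toAffine.Point → UnitsModCubes (ZMod p)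
  | .zero => 1
  | .some _ y _ => QuotientGroup.mk (descentUnit h0 y)

theorem descentClass_neg_some (h0 : t ≠ 0) {x y : ZMod p}
    (h : (curveE p t).toAffine.Equation x y) :
    (QuotientGroup.mk (descentUnit h0 ((curveE p t).toAffine.negY x y)) :
      UnitsModCubes (ZMod p)) * QuotientGroup.mk (descentUnit h0 y) = 1 := by
  rw [← QuotientGroup.mk_mul, mk_unitsModCubes_eq_one_iff, mul_comm]
  simpa [Affine.negY, curveE] using descentUnit_mul_neg h0 ((curveE_equation_iff p t x y).mp h)

theorem descentUnit_mul_of_slope (h0 : t ≠ 0) {x₁ x₂ y₁ y₂ : ZMod p}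
    (h₁ : (curveE p t).toAffine.Equation x₁ y₁) (h₂ : (curveE p t).toAffine.Equation x₂ y₂)
    (hxy : ¬(x₁ = x₂ ∧ y₁ = (curveE p t).toAffine.negY x₂ y₂)) :
    ∃ c : ZMod p, c ^ 3 = descentUnit h0 y₁ * descentUnit h0 y₂ *
      descentUnit h0 ((curveE p t).toAffine.negAddY x₁ x₂ y₁
        ((curveE p t).toAffine.slope x₁ x₂ y₁ y₂)) := by
  have hpoly := Affine.addPolynomial_slope h₁ h₂ hxy
  have hy₂ : y₂ = (curveE p t).toAffine.slope x₁ x₂ y₁ y₂ * (x₂ - x₁) + y₁ := by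
    by_cases hx : x₁ = x₂
    · rw [hx, sub_self, mul_zero, zero_add]
      exact (Affine.Y_eq_of_Y_ne h₁ h₂ hx fun h => hxy ⟨hx, h⟩).symm
    · rw [Affine.slope_of_X_ne hx, ← neg_sub x₁ x₂, mul_neg,
        div_mul_cancel₀ _ (sub_ne_zero_of_ne hx)]
      ring
  rw [Affine.addPolynomial_eq, neg_inj, Cubic.prod_X_sub_C_eq, Cubic.toPoly_injective] at hpoly
  set l := (curveE p t).toAffine.slope x₁ x₂ y₁ y₂
  simp only [Cubic.mk.injEq, true_and, Affine.addX, curveE] at hpoly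
  obtain ⟨-, ec, ed⟩ := hpoly
  have key := descentUnit_mul_of_collinear h0 (l := l) (m := y₁ - l * x₁) (x₁ := x₁) (x₂ := x₂)
    (x₃ := (curveE p t).toAffine.addX x₁ x₂ l)
    (by simp only [Affine.addX, curveE]; ring)
    (by simp only [Affine.addX, curveE]; linear_combination -ec)
    (by simp only [Affine.addX, curveE]; linear_combination ed)
  rw [show l * x₁ + (y₁ - l * x₁) = y₁ by ring,
    show l * x₂ + (y₁ - l * x₁) = y₂ by rw [hy₂]; ring] at key
  rw [Affine.negAddY, show l * ((curveE p t).toAffine.addX x₁ x₂ l - x₁) + y₁ =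
    l * (curveE p t).toAffine.addX x₁ x₂ l + (y₁ - l * x₁) by ring]
  exact key

/-- The descent map as a homomorphism. -/
def descentHom (h0 : t ≠ 0) :
    (curveE p t).toAffine.Point →+ Additive (UnitsModCubes (ZMod p)) :=
  AddMonoidHom.mk' (fun P => Additive.ofMul (descentClass h0 P)) <| by
    rintro P Q
    rw [← ofMul_mul]
    congr 1
    rcases P with _ | ⟨x₁, y₁, h₁⟩
    · rw [← Affine.Point.zero_def, zero_add]
      exact (one_mul _).symm
    rcases Q with _ | ⟨x₂, y₂, h₂⟩
    · rw [← Affine.Point.zero_def, add_zero]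
      exact (mul_one _).symm
    by_cases hxy : x₁ = x₂ ∧ y₁ = (curveE p t).toAffine.negY x₂ y₂
    · rw [Affine.Point.add_of_Y_eq hxy.1 hxy.2]
      obtain ⟨rfl, rfl⟩ := hxy
      exact (descentClass_neg_some h0 h₂.1).symm
    · rw [Affine.Point.add_some hxy]
      -- P + Q is the reflection of the third intersection point R, so the class of P + Q and the
      -- product of the classes of P and Q are both inverse to the class of R.
      have hneg := descentClass_neg_some h0 (Affine.equation_negAdd h₁.1 h₂.1 hxy)
      have hc := descentUnit_mul_of_slope h0 h₁.1 h₂.1 hxy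
      rw [← Units.val_mul, ← Units.val_mul, ← mk_unitsModCubes_eq_one_iff,
        QuotientGroup.mk_mul, QuotientGroup.mk_mul] at hc
      exact mul_right_cancel (hneg.trans hc.symm)

end CurveE

/-! ### The covering of the descent kernel by the Hesse cubic. -/

section HesseCover

variable {F : Type*} [Field F] [Fintype F] [DecidableEq F] {t : F}

/-- On a finite abelian group, the kernel and cokernel of cubing have the same order. -/
theorem card_unitsModCubes_le : Nat.card (UnitsModCubes F) ≤ cubeRootCount F := by
  have h : Nat.card (UnitsModCubes F) = Nat.card (powMonoidHom 3 : Fˣ →* Fˣ).ker :=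
    Subgroup.index_range
  rw [h, cubeRootCount, ← Fintype.card_subtype, ← Nat.card_eq_fintype_card]
  refine Nat.card_le_card_of_injective
    (fun u : (powMonoidHom 3 : Fˣ →* Fˣ).ker => (⟨(u.1 : F), ?_⟩ : {z : F // z ^ 3 = 1})) ?_
  · have hu := MonoidHom.mem_ker.mp u.2
    rw [powMonoidHom_apply] at hu
    simpa using congrArg Units.val hu
  · intro u v huv
    exact Subtype.ext (Units.ext (congrArg Subtype.val huv))

/-- The affine curve `u³ + w³ + t = 3uw` covers, through `(u, w) ↦ (-uw, u³)`, the points of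
`y² + 3xy + ty = x³` with trivial descent class. -/
theorem card_hesse_eq_mul (h0 : t ≠ 0) :
    (Finset.univ.filter fun v : F × F => v.1 ^ 3 + v.2 ^ 3 + t = 3 * v.1 * v.2).card =
      cubeRootCount F * (Finset.univ.filter fun v : F × F =>
        v.2 ^ 2 + 3 * v.1 * v.2 + t * v.2 = v.1 ^ 3 ∧
          ∃ c : F, c ^ 3 = descentUnit h0 v.2).card := by
  rw [Finset.card_eq_sum_card_fiberwise (f := fun v : F × F => (-(v.1 * v.2), v.1 ^ 3))
    (t := Finset.univ.filter fun v : F × F => v.2 ^ 2 + 3 * v.1 * v.2 + t * v.2 = v.1 ^ 3 ∧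
          ∃ c : F, c ^ 3 = descentUnit h0 v.2), mul_comm, ← smul_eq_mul]
  · refine Finset.sum_eq_card_nsmul ?_
    rintro ⟨x, y⟩ hxy
    simp only [Finset.mem_filter, Finset.mem_univ, true_and] at hxy
    obtain ⟨he, c, hc⟩ := hxy
    -- Over (0, 0) the fibre is u = 0, w³ = -t; elsewhere u is a cube root of y and w = -x/u is
    -- forced.
    rcases eq_or_ne y 0 with rfl | hy
    · obtain rfl : x = 0 := by simpa using he.symm
      rw [descentUnit_zero] at hc
      have hc0 : c ≠ 0 := by
        rintro rfl
        exact inv_ne_zero h0 (by rw [← hc]; simp)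
      rw [← card_cube_roots (neg_ne_zero.mpr h0) ⟨-c⁻¹, by
        rw [neg_pow, inv_pow, hc, inv_inv]; ring⟩]
      refine Finset.card_bij' (fun v _ => v.2) (fun w _ => (0, w)) ?_ ?_ ?_ ?_
      · rintro ⟨u, w⟩ h
        simp only [Finset.mem_filter, Finset.mem_univ, true_and, Prod.mk.injEq] at h ⊢
        obtain ⟨h, -, hu⟩ := h
        obtain rfl : u = 0 := by simpa using hu
        linear_combination h
      · intro w h
        simp only [Finset.mem_filter, Finset.mem_univ, true_and, Prod.mk.injEq] at h ⊢
        refine ⟨?_, by simp, by simp⟩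
        linear_combination h
      · rintro ⟨u, w⟩ h
        simp only [Finset.mem_filter, Finset.mem_univ, true_and, Prod.mk.injEq] at h ⊢
        obtain ⟨h, -, hu⟩ := h
        exact ⟨(by simpa using hu : u = 0).symm, trivial⟩
      · intro w _
        rfl
    · rw [descentUnit_of_ne h0 hy] at hc
      rw [← card_cube_roots hy ⟨c, hc⟩]
      refine Finset.card_bij' (fun v _ => v.1) (fun u _ => (u, -x / u)) ?_ ?_ ?_ ?_
      · rintro ⟨u, w⟩ h
        simp only [Finset.mem_filter, Finset.mem_univ, true_and, Prod.mk.injEq] at h ⊢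
        exact h.2.2
      · intro u h
        simp only [Finset.mem_filter, Finset.mem_univ, true_and, Prod.mk.injEq] at h ⊢
        have hu : u ≠ 0 := by
          rintro rfl
          exact hy (by rw [← h]; simp)
        refine ⟨?_, by field_simp, h⟩
        rw [← h] at he
        field_simp
        linear_combination he
      · rintro ⟨u, w⟩ h
        simp only [Finset.mem_filter, Finset.mem_univ, true_and, Prod.mk.injEq] at h ⊢
        obtain ⟨-, rfl, rfl⟩ := h
        have hu : u ≠ 0 := by
          rintro rfl
          simp at hy
        field_simp
      · intro u _
        rfl
  · rintro ⟨u, w⟩ h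
    simp only [Finset.coe_filter, Finset.mem_univ, true_and, Set.mem_ofPred_eq] at h ⊢
    refine ⟨by linear_combination u ^ 3 * h, ?_⟩
    rcases eq_or_ne u 0 with rfl | hu
    · have hw : w ^ 3 = -t := by linear_combination h
      refine ⟨-w⁻¹, ?_⟩
      rw [zero_pow three_ne_zero, descentUnit_zero, neg_pow, inv_pow, hw, inv_neg]
      ring
    · exact ⟨u, by rw [descentUnit_of_ne h0 (pow_ne_zero 3 hu)]⟩

end HesseCover

/-! ### Comparison of the point counts. -/

section PointCount

open WeierstrassCurve

variable {p : ℕ} [Fact p.Prime] {t : ZMod p}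

/-- Serves both the full group and the descent kernel; the extra 1 is the point at infinity. -/
theorem card_point_subtype (hp : 3 < p) (h0 : t ≠ 0) (h1 : t ≠ 1)
    (Q : (curveE p t).toAffine.Point → Prop) (q : ZMod p → Prop) [DecidablePred q] (hz : Q .zero)
    (hQ : ∀ x y h, Q (.some x y h) ↔ q y) :
    Nat.card {P // Q P} = (Finset.univ.filter fun v : ZMod p × ZMod p =>
      v.2 ^ 2 + 3 * v.1 * v.2 + t * v.2 = v.1 ^ 3 ∧ q v.2).card + 1 := by
  have := curveE_isElliptic p hp t h0 h1
  have hP : ∀ v : ZMod p × ZMod p,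
      (∃ h : (curveE p t).toAffine.Equation v.1 v.2, Q (.mk h)) ↔
        (v.2 ^ 2 + 3 * v.1 * v.2 + t * v.2 = v.1 ^ 3 ∧ q v.2) := fun v => by
    rw [← curveE_equation_iff]
    exact ⟨fun ⟨h, h'⟩ => ⟨h, (hQ _ _ _).mp h'⟩, fun ⟨h, h'⟩ => ⟨h, (hQ _ _ _).mpr h'⟩⟩
  rw [Nat.card_congr (Affine.pointEquivSubtype hz), ← Fintype.card_subtype,
    ← Nat.card_eq_fintype_card, ← Nat.card_congr (Equiv.subtypeEquivRight hP)]
  exact Finite.card_option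

theorem card_point (hp : 3 < p) (h0 : t ≠ 0) (h1 : t ≠ 1) :
    Nat.card (curveE p t).toAffine.Point = (Finset.univ.filter fun v : ZMod p × ZMod p =>
      v.2 ^ 2 + 3 * v.1 * v.2 + t * v.2 = v.1 ^ 3).card + 1 := by
  have h := card_point_subtype hp h0 h1 (fun _ => True) (fun _ => True) trivial
    fun _ _ _ => Iff.rfl
  rw [Nat.card_congr (Equiv.subtypeUnivEquiv fun _ => trivial)] at h
  rw [h]
  congr 2
  ext v
  simp

theorem card_descentHom_ker (hp : 3 < p) (h0 : t ≠ 0) (h1 : t ≠ 1) :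
    Nat.card (descentHom h0).ker = (Finset.univ.filter fun v : ZMod p × ZMod p =>
      v.2 ^ 2 + 3 * v.1 * v.2 + t * v.2 = v.1 ^ 3 ∧
        ∃ c : ZMod p, c ^ 3 = descentUnit h0 v.2).card + 1 :=
  card_point_subtype hp h0 h1 (fun P => P ∈ (descentHom h0).ker)
    (fun y => ∃ c : ZMod p, c ^ 3 = descentUnit h0 y) (zero_mem _)
    fun _ _ _ => AddMonoidHom.mem_ker.trans (mk_unitsModCubes_eq_one_iff _)

theorem traceOfFrobenius_curveE (hp : 3 < p) (h0 : t ≠ 0) (h1 : t ≠ 1) (h2 : (2 : ZMod p) ≠ 0) :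
    traceOfFrobenius p (curveE p t) = -cubicCharSum t := by
  have h := card_affine_curveE h2 h0
  rw [ZMod.card] at h
  rw [traceOfFrobenius, card_point hp h0 h1]
  push_cast
  linarith

theorem card_point_bounds (hp : 3 < p) (h0 : t ≠ 0) (h1 : t ≠ 1) :
    Nat.card (descentHom h0).ker ≤ Nat.card (curveE p t).toAffine.Point ∧
      Nat.card (curveE p t).toAffine.Point ≤
        cubeRootCount (ZMod p) * Nat.card (descentHom h0).ker := by
  have hfin : Finite (curveE p t).toAffine.Point :=
    Nat.finite_of_card_ne_zero (by rw [card_point hp h0 h1]; omega)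
  refine ⟨Nat.card_le_card_of_injective _ Subtype.val_injective, ?_⟩
  rw [← AddSubgroup.card_mul_index (descentHom h0).ker, mul_comm]
  refine Nat.mul_le_mul_right _ ?_
  rw [AddSubgroup.index_ker]
  exact (Nat.card_le_card_of_injective _ Subtype.val_injective).trans card_unitsModCubes_le

theorem cubicCharSum_relations (hp : 3 < p) (h0 : t ≠ 0) (h1 : t ≠ 1)
    (h2 : (2 : ZMod p) ≠ 0) (h3 : (3 : ZMod p) ≠ 0) :
    (quadraticChar (ZMod p) (-3) = 1 → cubicCharSum t ≤ cubicCharSum (1 - t)) ∧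
      (quadraticChar (ZMod p) (-3) = -1 → cubicCharSum t = -cubicCharSum (1 - t)) := by
  obtain ⟨hle, hge⟩ := card_point_bounds hp h0 h1
  have hk := cubeRootCount_eq h2 h3
  have hC := card_affine_hesse h2 h3 h1
  have hE := card_affine_curveE h2 h0
  rw [card_point hp h0 h1] at hle hge
  rw [card_hesse_eq_mul h0] at hC
  rw [card_descentHom_ker hp h0 h1] at hle hge
  rw [ZMod.card] at hC hE
  generalize (Finset.univ.filter fun v : ZMod p × ZMod p =>
    v.2 ^ 2 + 3 * v.1 * v.2 + t * v.2 = v.1 ^ 3).card = N at hE hle hge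
  push_cast at hC
  zify at hle hge
  rw [hk] at hC hge
  -- For χ = 1 only the upper bound is used; for χ = -1 the factor k is 1 and the two bounds
  -- coincide.
  constructor <;> intro hχ <;> rw [hχ] at hC hge <;> linarith

end PointCount

theorem proposition3p1 (p : ℕ) [Fact p.Prime] (hp : 3 < p) (t : ZMod p)
    (h0 : t ≠ 0) (h1 : t ≠ 1) :
    traceOfFrobenius p (curveE p t) =
      legendreSym p (-3) * traceOfFrobenius p (curveE p (1 - t)) := by
  have hne : ∀ n : ℕ, 0 < n → n < p → (n : ZMod p) ≠ 0 := fun n hn hnp h =>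
    absurd (Nat.le_of_dvd hn ((ZMod.natCast_eq_zero_iff n p).mp h)) (by omega)
  have h2 : (2 : ZMod p) ≠ 0 := by exact_mod_cast hne 2 (by omega) (by omega)
  have h3 : (3 : ZMod p) ≠ 0 := by exact_mod_cast hne 3 (by omega) hp
  have h0' : 1 - t ≠ 0 := sub_ne_zero.mpr h1.symm
  have h1' : 1 - t ≠ 1 := fun h => h0 (by linear_combination -h)
  rw [traceOfFrobenius_curveE hp h0 h1 h2, traceOfFrobenius_curveE hp h0' h1' h2, legendreSym]
  push_cast
  obtain ⟨hpos, hneg⟩ := cubicCharSum_relations hp h0 h1 h2 h3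
  rcases quadraticChar_dichotomy (neg_ne_zero.mpr h3) with hχ | hχ
  -- The same inequality at 1 - t closes the sandwich.
  · have hpos' := (cubicCharSum_relations hp h0' h1' h2 h3).1 hχ
    rw [sub_sub_cancel] at hpos'
    rw [hχ, le_antisymm (hpos hχ) hpos', one_mul]
  · rw [hχ, hneg hχ]
    ring
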